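/- Let $\Omega=\{\omega\in C([0,1],\mathbb{R}):\omega(0)=0\}$ be equipped with the uniform metric and its Borel $\sigma$-algebra, and let $W$ be the Wiener measure on $\Omega$, i.e. the law of standard Brownian motion on $[0,1]$: the Borel probability measure under which $(\omega(t))_{t\in[0,1]}$ is a centered Gaussian process with covariance $\min(s,t)$. For $\bar\omega\in\Omega$ and $\varepsilon>0$ let $B(\bar\omega,\varepsilon)$ be the open uniform ball, and define the upper local order of $W$ at $\bar\omega$ by $$\overline{\mathsf{ord}}_{\mathrm{loc}}W(\bar\omega)=\inf\Big\{\gamma>0:\ \frac{W(B(\bar\omega,\varepsilon))}{\exp(-\varepsilon^{-\gamma})}\longrightarrow+\infty\ \text{ as }\varepsilon\to0^+\Big\}\in[0,+\infty],\qquad \inf\emptyset=+\infty.$$ For $\alpha\in(0,1]$ let $C_\alpha^-\subset\Omega$ be the set of paths that are $\beta$-Hölder on $[0,1]$ for every $0<\beta<\alpha$. **Theorem.** Let $\alpha\in(0,1/2]$. Then for every $\bar\omega\in C_\alpha^-$, $$\overline{\mathsf{ord}}_{\mathrm{loc}}W(\bar\omega)\le 2\,(\alpha^{-1}-1).$$ 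-/

import Mathlib

open MeasureTheory ProbabilityTheory Filter Topology Set
open scoped NNReal ENNReal unitInterval

/-- The Wiener space: continuous functions `ω : [0,1] → ℝ` with `ω 0 = 0`. As a subtype of
`C([0,1], ℝ)` it carries the metric of the uniform norm. -/
abbrev PathSpace : Type := {ω : C(I, ℝ) // ω 0 = 0}

/-- `PathSpace` carries the Borel σ-algebra of the uniform metric. -/
instance PathSpace.instMeasurableSpace : MeasurableSpace PathSpace := borel PathSpace

instance PathSpace.instBorelSpace : BorelSpace PathSpace := ⟨rfl⟩

/-- The Wiener measure, i.e. the law of standard Brownian motion on `[0,1]`: the (unique) Borel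
probability measure on `PathSpace` under which the coordinate process `t ↦ ω t` is a centered
Gaussian process with covariance `min s t`. -/
structure IsWienerMeasure (W : Measure PathSpace) : Prop where
  isProbabilityMeasure : IsProbabilityMeasure W
  isGaussianProcess : IsGaussianProcess (fun (t : I) (ω : PathSpace) => ω.1 t) W
  integral_eval : ∀ t : I, ∫ ω, ω.1 t ∂W = 0
  covariance_eval : ∀ s t : I,
    cov[fun ω : PathSpace => ω.1 s, fun ω : PathSpace => ω.1 t; W] = min (s : ℝ) (t : ℝ)

/-- The set `C_β` of `β`-Hölder paths (used for `β > 0`). -/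
def holderPaths (β : ℝ) : Set PathSpace :=
  {ω | MemHolder β.toNNReal (fun t : I => ω.1 t)}

/-- The set `C_α^-` of nearly `α`-Hölder paths: paths that are `β`-Hölder for all `0 < β < α`. -/
def nearlyHolderPaths (α : ℝ) : Set PathSpace :=
  ⋂ β ∈ Ioo (0 : ℝ) α, holderPaths β

/-- The upper local scale at `x` of a Borel measure `μ` on a metric space, relative to a scaling
`scl = (scl γ)_{γ > 0}`: the infimum (in `[0, ∞]`, with `inf ∅ = ∞`) of the `γ > 0` such that
`μ (B(x, ε)) / scl γ ε → ∞` as `ε → 0+`. -/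
noncomputable def upperLocalScale {X : Type*} [PseudoMetricSpace X] [MeasurableSpace X]
    (scl : ℝ → ℝ → ℝ) (μ : Measure X) (x : X) : EReal :=
  sInf ((fun γ : ℝ => (γ : EReal)) '' {γ : ℝ | 0 < γ ∧
    Tendsto (fun ε : ℝ => μ (Metric.ball x ε) / ENNReal.ofReal (scl γ ε)) (𝓝[>] 0) (𝓝 ⊤)})

/-- The scaling `ord`, namely `ord_γ(ε) = exp (-ε^{-γ})`. -/
noncomputable def ordScaling (γ ε : ℝ) : ℝ := Real.exp (-(ε ^ (-γ)))

/-- The upper local order of `μ` at `x`: the upper local scale relative to `ord`. -/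
noncomputable def upperLocalOrder {X : Type*} [PseudoMetricSpace X] [MeasurableSpace X]
    (μ : Measure X) (x : X) : EReal :=
  upperLocalScale ordScaling μ x

/-! In the Faber-Schauder expansion of Brownian motion the coefficients are independent centered
Gaussians, of variance `1 / (4 * 2 ^ n)` at level `n` (`IsWienerMeasure.measure_schauderBox`). A
uniform ball contains a box of coefficients whose radii, one per level, are summable, so its measure
is at least a product of Gaussian measures of intervals.

Let the center be `β`-Hölder, `β < 1/2`, and put `ρ = 2 ^ (-β)`, `r = 2 * ρ ^ 2 > 1`. Its level `n`
coefficients are `O(ρ ^ n)`. Fix `m`. Below level `m`, radius `2 ^ (-m)` costs `O(r ^ m)` in the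
exponent for each of `2 ^ m` coefficients. From level `m` on, radius `2 * K * ρ ^ n` far exceeds the
standard deviation, and the total cost is bounded. Hence a ball of radius `O(ρ ^ m)` has measure at
least `exp (-C * (2 * r) ^ m)` (`IsWienerMeasure.measure_closedBall_ge`). As `2 * r = ρ ^ (-(2 / β -
2))`, this gives order at most `2 / β - 2`; then `β` tends to `α`. -/

/-! ### Gaussian measure of intervals -/

/-- A lower bound for the centered Gaussian measure of an interval of radius `b`. -/
theorem gaussianReal_closedBall_ge {v : ℝ≥0} (hv : v ≠ 0) (hv1 : v ≤ 1) {c b R : ℝ}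
    (hR : |c| + b ≤ R) :
    ENNReal.ofReal (b / 2 * Real.exp (-(R ^ 2 / (2 * v)))) ≤
      gaussianReal 0 v (Metric.closedBall c b) := by
  have hv0 : (0 : ℝ) < v := by positivity
  have hv1' : (v : ℝ) ≤ 1 := by exact_mod_cast hv1
  have hsqrt : √(2 * Real.pi * v) ≤ 4 := by
    rw [Real.sqrt_le_left (by norm_num)]
    nlinarith [Real.pi_lt_four, Real.pi_pos]
  have hsqrt0 : 0 < √(2 * Real.pi * v) := by positivity
  rw [gaussianReal_apply 0 hv]
  calc ENNReal.ofReal (b / 2 * Real.exp (-(R ^ 2 / (2 * v))))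
      = ENNReal.ofReal (4⁻¹ * Real.exp (-(R ^ 2 / (2 * v)))) * volume (Metric.closedBall c b) := by
        rw [Real.volume_closedBall, ← ENNReal.ofReal_mul (by positivity)]
        congr 1; ring
    _ = ∫⁻ _ in Metric.closedBall c b, ENNReal.ofReal (4⁻¹ * Real.exp (-(R ^ 2 / (2 * v)))) := by
        rw [setLIntegral_const]
    _ ≤ _ := by
        refine setLIntegral_mono (measurable_gaussianPDF 0 v) fun x hx => ?_
        rw [gaussianPDF_def]
        refine ENNReal.ofReal_le_ofReal ?_
        rw [gaussianPDFReal, sub_zero, neg_div]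
        have hx' : |x| ≤ R := by
          have h1 : |x - c| ≤ b := by simpa [Real.dist_eq] using hx
          have h2 : |x| ≤ |x - c| + |c| := by simpa using abs_add_le (x - c) c
          linarith
        have hsq : x ^ 2 ≤ R ^ 2 := sq_le_sq' (by linarith [neg_abs_le x]) (le_trans (le_abs_self x) hx')
        gcongr

/-- The Gaussian tail bound. -/
theorem gaussianReal_compl_closedBall_le {v : ℝ≥0} {t : ℝ} (ht : 0 ≤ t) :
    (gaussianReal 0 v).real {x | t < |x|} ≤ 2 * Real.exp (-(t ^ 2 / (2 * v))) := by
  have hid : HasSubgaussianMGF (fun x : ℝ => x) v (gaussianReal 0 v) :=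
    ⟨fun s => integrable_exp_mul_gaussianReal s, fun s => by
      rw [mgf_fun_id_gaussianReal]; simp⟩
  have h1 := hid.measure_ge_le ht
  have h2 := hid.neg.measure_ge_le ht
  have hsub : {x : ℝ | t < |x|} ⊆ {x | t ≤ x} ∪ {x | t ≤ -x} := by
    intro x hx
    rcases lt_abs.1 (show t < |x| from hx) with h | h
    · exact Or.inl h.le
    · exact Or.inr h.le
  calc (gaussianReal 0 v).real {x | t < |x|}
      ≤ (gaussianReal 0 v).real ({x | t ≤ x} ∪ {x | t ≤ -x}) := measureReal_mono hsub
    _ ≤ _ := measureReal_union_le _ _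
    _ ≤ Real.exp (-t ^ 2 / (2 * v)) + Real.exp (-t ^ 2 / (2 * v)) := add_le_add h1 h2
    _ = _ := by rw [neg_div]; ring

/-- Turns a probability close to 1 into an exponential, so that products of such factors become sums
of costs. -/
theorem exp_neg_two_mul_le_one_sub {x : ℝ} (h0 : 0 ≤ x) (h1 : x ≤ 1 / 2) :
    Real.exp (-(2 * x)) ≤ 1 - x := by
  rw [Real.exp_neg]
  refine inv_le_of_inv_le₀ (by linarith) ?_
  refine le_trans ?_ (Real.add_one_le_exp (2 * x))
  rw [inv_le_iff_one_le_mul₀ (by linarith)]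
  nlinarith

/-- An interval whose radius is twice the bound on its center has almost full Gaussian measure. -/
theorem gaussianReal_closedBall_ge_exp {v : ℝ≥0} {c t : ℝ} (hct : |c| ≤ t)
    (ht : 2 * Real.exp (-(t ^ 2 / (2 * v))) ≤ 1 / 2) :
    ENNReal.ofReal (Real.exp (-(4 * Real.exp (-(t ^ 2 / (2 * v)))))) ≤
      gaussianReal 0 v (Metric.closedBall c (2 * t)) := by
  have ht0 : 0 ≤ t := (abs_nonneg c).trans hct
  -- Doubling the radius absorbs the shift by `c`: the interval still contains `[-t, t]`.
  have hsub : {x : ℝ | t < |x|}ᶜ ⊆ Metric.closedBall c (2 * t) := by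
    intro x hx
    have hx' : |x| ≤ t := by simpa using hx
    rw [Metric.mem_closedBall, Real.dist_eq]
    linarith [abs_sub x c]
  refine le_trans ?_ (measure_mono hsub)
  have hmeas : MeasurableSet {x : ℝ | t < |x|} := measurableSet_lt (by fun_prop) (by fun_prop)
  rw [← ofReal_measureReal, probReal_compl_eq_one_sub hmeas]
  refine ENNReal.ofReal_le_ofReal ?_
  have h := exp_neg_two_mul_le_one_sub (x := 2 * Real.exp (-(t ^ 2 / (2 * v)))) (by positivity) ht
  rw [← mul_assoc] at h
  norm_num at h
  linarith [gaussianReal_compl_closedBall_le (v := v) ht0]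


/-! ### Dyadic points and Faber-Schauder coefficients -/

/-- The dyadic point `k / 2 ^ n` of the unit interval. -/
noncomputable def dyadicPt (n k : ℕ) : I :=
  ⟨min ((k : ℝ) / 2 ^ n) 1, le_min (by positivity) zero_le_one, min_le_right _ _⟩

theorem dyadicPt_coe {n k : ℕ} (h : k ≤ 2 ^ n) : (dyadicPt n k : ℝ) = (k : ℝ) / 2 ^ n := by
  refine min_eq_left ?_
  rw [div_le_one (by positivity)]
  exact_mod_cast h

theorem dyadicPt_succ_two_mul (n k : ℕ) : dyadicPt (n + 1) (2 * k) = dyadicPt n k := by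
  ext
  simp only [dyadicPt]
  congr 1
  push_cast
  field_simp
  ring

/-- The second difference of `f` at the points `l, m, r`. -/
noncomputable def midDiff (f : I → ℝ) (l m r : I) : ℝ := f m - (f l + f r) / 2

/-- Indices of the Faber-Schauder basis of the space of paths: the function `t ↦ t` and the tents
over the dyadic intervals. -/
abbrev SchauderIndex : Type := Option (Σ n : ℕ, Fin (2 ^ n))

/-- Faber-Schauder coefficients. -/
noncomputable def schauderCoeff : SchauderIndex → (I → ℝ) → ℝ
  | none, f => f 1
  | some ⟨n, k⟩, f =>
      midDiff f (dyadicPt (n + 1) (2 * k)) (dyadicPt (n + 1) (2 * k + 1))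
        (dyadicPt (n + 1) (2 * k + 2))

theorem schauderCoeff_sub (i : SchauderIndex) (f g : I → ℝ) :
    schauderCoeff i (fun t => f t - g t) = schauderCoeff i f - schauderCoeff i g := by
  rcases i with _ | ⟨n, k⟩
  · rfl
  · simp only [schauderCoeff, midDiff]; ring

/-- A function is controlled at dyadic points by its Faber-Schauder coefficients. -/
theorem abs_dyadicPt_le_of_schauderCoeff {f : I → ℝ} (h0 : f 0 = 0) {B : ℝ} {b : ℕ → ℝ}
    (hB : |schauderCoeff none f| ≤ B) (N : ℕ)
    (hb : ∀ n < N, ∀ k : Fin (2 ^ n), |schauderCoeff (some ⟨n, k⟩) f| ≤ b n)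
    (k : ℕ) (hk : k ≤ 2 ^ N) : |f (dyadicPt N k)| ≤ B + ∑ n ∈ Finset.range N, b n := by
  induction N generalizing k with
  | zero =>
    have h00 : dyadicPt 0 0 = 0 := by ext; simp [dyadicPt]
    have h01 : dyadicPt 0 1 = 1 := by ext; simp [dyadicPt]
    simp only [Finset.range_zero, Finset.sum_empty, add_zero]
    rcases Nat.le_one_iff_eq_zero_or_eq_one.1 (by simpa using hk) with rfl | rfl
    · rw [h00, h0, abs_zero]; exact (abs_nonneg _).trans hB
    · rw [h01]; exact hB
  | succ N ih =>
    have ih' := ih fun n hn => hb n (hn.trans (Nat.lt_succ_self N))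
    rw [Finset.sum_range_succ]
    have hbN : 0 ≤ b N :=
      (abs_nonneg _).trans (hb N (Nat.lt_succ_self N) ⟨0, by positivity⟩)
    rw [pow_succ] at hk
    -- Even points belong to level `N`; at an odd point the value is a coefficient plus the mean of
    -- two level `N` neighbours.
    rcases Nat.even_or_odd' k with ⟨j, rfl | rfl⟩
    · rw [dyadicPt_succ_two_mul]
      linarith [ih' j (by omega)]
    · have hj : j < 2 ^ N := by omega
      have h := hb N (Nat.lt_succ_self N) ⟨j, hj⟩
      have h1 := ih' j hj.le
      have h2 := ih' (j + 1) hj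
      simp only [schauderCoeff, midDiff] at h
      rw [show 2 * j + 2 = 2 * (j + 1) by ring, dyadicPt_succ_two_mul, dyadicPt_succ_two_mul] at h
      rw [abs_le] at h h1 h2 ⊢
      constructor <;> linarith

theorem tendsto_dyadicPt_floor (t : I) :
    Tendsto (fun N => dyadicPt N ⌊(t : ℝ) * 2 ^ N⌋₊) atTop (𝓝 t) := by
  rw [tendsto_subtype_rng]
  have h : Tendsto (fun N : ℕ => (⌊(t : ℝ) * 2 ^ N⌋₊ : ℝ) / 2 ^ N) atTop (𝓝 (t : ℝ)) :=
    (tendsto_nat_floor_mul_div_atTop t.2.1).comp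
      (tendsto_pow_atTop_atTop_of_one_lt (one_lt_two : (1 : ℝ) < 2))
  have h2 := h.min (tendsto_const_nhds (x := (1 : ℝ)))
  rwa [min_eq_left t.2.2] at h2

theorem abs_le_of_schauderCoeff {f : I → ℝ} (hf : Continuous f) (h0 : f 0 = 0) {B S : ℝ}
    {b : ℕ → ℝ} (hB : |schauderCoeff none f| ≤ B)
    (hb : ∀ n, ∀ k : Fin (2 ^ n), |schauderCoeff (some ⟨n, k⟩) f| ≤ b n)
    (hS : ∀ N, B + ∑ n ∈ Finset.range N, b n ≤ S) (t : I) : |f t| ≤ S := by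
  refine le_of_tendsto ((hf.abs.tendsto t).comp (tendsto_dyadicPt_floor t))
    (Eventually.of_forall fun N => ?_)
  refine (abs_dyadicPt_le_of_schauderCoeff h0 hB N (fun n _ => hb n) _ ?_).trans (hS N)
  refine Nat.floor_le_of_le ?_
  push_cast
  exact mul_le_of_le_one_left (by positivity) t.2.2

/-- `min p` is affine on intervals that do not contain `p` in their interior. -/
theorem min_midpoint {p l m r : ℝ} (hl : l ≤ m) (hr : m ≤ r) (hm : m = (l + r) / 2)
    (hp : p ≤ l ∨ r ≤ p) :
    min p m - (min p l + min p r) / 2 = 0 := by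
  rcases hp with hp | hp
  · rw [min_eq_left hp, min_eq_left (hp.trans hl), min_eq_left ((hp.trans hl).trans hr)]; ring
  · rw [min_eq_right hp, min_eq_right (hr.trans hp), min_eq_right ((hl.trans hr).trans hp)]
    linarith

/-! ### Law of the coefficients under Wiener measure -/

section Wiener

variable {W : Measure PathSpace}

theorem continuous_pathEval (t : I) : Continuous (fun ω : PathSpace => ω.1 t) :=
  (continuous_eval_const t).comp continuous_subtype_val

theorem measurable_schauderCoeff (i : SchauderIndex) :
    Measurable (fun ω : PathSpace => schauderCoeff i ω.1) := by
  have h := fun t => (continuous_pathEval t).measurable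
  rcases i with _ | ⟨n, k⟩
  · exact h 1
  · exact (h _).sub (((h _).add (h _)).div_const 2)

theorem IsWienerMeasure.memLp_eval (hW : IsWienerMeasure W) (t : I) :
    MemLp (fun ω : PathSpace => ω.1 t) 2 W :=
  (hW.isGaussianProcess.hasGaussianLaw_eval t).memLp_two

theorem IsWienerMeasure.memLp_midDiff (hW : IsWienerMeasure W) (l m r : I) :
    MemLp (fun ω : PathSpace => midDiff ω.1 l m r) 2 W := by
  have h := ((hW.memLp_eval l).add (hW.memLp_eval r)).mul_const (2⁻¹ : ℝ)
  exact (hW.memLp_eval m).sub h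

theorem IsWienerMeasure.covariance_eval_midDiff (hW : IsWienerMeasure W) (p l m r : I) :
    cov[fun ω : PathSpace => ω.1 p, fun ω => midDiff ω.1 l m r; W] =
      min (p : ℝ) m - (min (p : ℝ) l + min (p : ℝ) r) / 2 := by
  have := hW.isProbabilityMeasure
  have hlr := (hW.memLp_eval l).add (hW.memLp_eval r)
  have h := hlr.mul_const (2⁻¹ : ℝ)
  have e : (fun ω : PathSpace => midDiff ω.1 l m r) = (fun ω : PathSpace => ω.1 m) -
      (fun ω : PathSpace => ((fun ω : PathSpace => ω.1 l) + (fun ω : PathSpace => ω.1 r)) ω * 2⁻¹) :=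
    rfl
  rw [e, covariance_sub_right (hW.memLp_eval p) (hW.memLp_eval m) h, covariance_mul_const_right,
    covariance_add_right (hW.memLp_eval p) (hW.memLp_eval l) (hW.memLp_eval r),
    hW.covariance_eval, hW.covariance_eval, hW.covariance_eval, div_eq_mul_inv]

theorem IsWienerMeasure.covariance_midDiff_left (hW : IsWienerMeasure W) {Y : PathSpace → ℝ}
    (hY : MemLp Y 2 W) (l m r : I) :
    cov[fun ω : PathSpace => midDiff ω.1 l m r, Y; W] =
      cov[fun ω : PathSpace => ω.1 m, Y; W] -
      (cov[fun ω : PathSpace => ω.1 l, Y; W] + cov[fun ω : PathSpace => ω.1 r, Y; W]) / 2 := by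
  have := hW.isProbabilityMeasure
  have hlr := (hW.memLp_eval l).add (hW.memLp_eval r)
  have h := hlr.mul_const (2⁻¹ : ℝ)
  have e : (fun ω : PathSpace => midDiff ω.1 l m r) = (fun ω : PathSpace => ω.1 m) -
      (fun ω : PathSpace => ((fun ω : PathSpace => ω.1 l) + (fun ω : PathSpace => ω.1 r)) ω * 2⁻¹) :=
    rfl
  rw [e, covariance_sub_left (hW.memLp_eval m) h hY, covariance_mul_const_left,
    covariance_add_left (hW.memLp_eval l) (hW.memLp_eval r) hY, div_eq_mul_inv]

theorem IsWienerMeasure.memLp_schauderCoeff (hW : IsWienerMeasure W) (i : SchauderIndex) :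
    MemLp (fun ω : PathSpace => schauderCoeff i ω.1) 2 W := by
  rcases i with _ | ⟨n, k⟩
  · exact hW.memLp_eval 1
  · exact hW.memLp_midDiff _ _ _

/-- Points outside the open dyadic interval `(n, k)` are uncorrelated with its coefficient. -/
theorem IsWienerMeasure.covariance_eval_schauderCoeff (hW : IsWienerMeasure W) (p : I) (n : ℕ)
    (k : Fin (2 ^ n)) (hp : (p : ℝ) ≤ k / 2 ^ n ∨ ((k : ℝ) + 1) / 2 ^ n ≤ p) :
    cov[fun ω : PathSpace => ω.1 p, fun ω => schauderCoeff (some ⟨n, k⟩) ω.1; W] = 0 := by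
  have hk := k.2
  simp only [schauderCoeff]
  rw [hW.covariance_eval_midDiff, dyadicPt_coe (by rw [pow_succ]; omega),
    dyadicPt_coe (by rw [pow_succ]; omega), dyadicPt_coe (by rw [pow_succ]; omega)]
  refine min_midpoint (by gcongr; omega) (by gcongr; omega) (by push_cast; ring) ?_
  have e1 : ((2 * (k : ℕ) : ℕ) : ℝ) / 2 ^ (n + 1) = k / 2 ^ n := by
    push_cast; field_simp; ring
  have e2 : ((2 * (k : ℕ) + 2 : ℕ) : ℝ) / 2 ^ (n + 1) = (k + 1) / 2 ^ n := by
    push_cast; field_simp; ring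
  rwa [e1, e2]

/-- The three dyadic points defining the coarser coefficient avoid the interior of the finer
interval, so each is uncorrelated with the finer coefficient. -/
theorem IsWienerMeasure.covariance_schauderCoeff_of_le (hW : IsWienerMeasure W) {n n' : ℕ}
    (hn : n ≤ n') (k : Fin (2 ^ n)) (k' : Fin (2 ^ n'))
    (h : (⟨n, k⟩ : Σ n : ℕ, Fin (2 ^ n)) ≠ ⟨n', k'⟩) :
    cov[fun ω : PathSpace => schauderCoeff (some ⟨n, k⟩) ω.1,
      fun ω => schauderCoeff (some ⟨n', k'⟩) ω.1; W] = 0 := by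
  have key : ∀ j : ℕ, 2 * (k : ℕ) ≤ j → j ≤ 2 * k + 2 →
      cov[fun ω : PathSpace => ω.1 (dyadicPt (n + 1) j),
        fun ω => schauderCoeff (some ⟨n', k'⟩) ω.1; W] = 0 := by
    intro j hj hj'
    refine hW.covariance_eval_schauderCoeff _ _ _ ?_
    have hk := k.2
    rw [dyadicPt_coe (by rw [pow_succ]; omega)]
    rcases hn.eq_or_lt with rfl | hlt
    · have hne : (k : ℕ) ≠ k' := fun e => h (by rw [Fin.ext e])
      rw [div_le_div_iff₀ (by positivity) (by positivity),
        div_le_div_iff₀ (by positivity) (by positivity), pow_succ]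
      have h2 : (0 : ℝ) < 2 ^ n := by positivity
      rcases hne.lt_or_gt with hlt | hlt
      · left
        have : (j : ℝ) ≤ k' * 2 := by exact_mod_cast (by omega : j ≤ k' * 2)
        nlinarith
      · right
        have : ((k' : ℝ) + 1) * 2 ≤ j := by exact_mod_cast (by omega : ((k' : ℕ) + 1) * 2 ≤ j)
        nlinarith
    · obtain ⟨d, rfl⟩ := Nat.exists_eq_add_of_le (Nat.succ_le_of_lt hlt)
      have e : (j : ℝ) / 2 ^ (n + 1) = ((j * 2 ^ d : ℕ) : ℝ) / 2 ^ (n.succ + d) := by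
        rw [pow_add, Nat.succ_eq_add_one]; push_cast; field_simp; ring
      rw [e]
      rcases Nat.lt_or_ge (k' : ℕ) (j * 2 ^ d) with hlt | hge
      · right; gcongr; exact_mod_cast hlt
      · left; gcongr
  have hL := hW.covariance_midDiff_left (hW.memLp_schauderCoeff (some ⟨n', k'⟩))
    (dyadicPt (n + 1) (2 * k)) (dyadicPt (n + 1) (2 * k + 1)) (dyadicPt (n + 1) (2 * k + 2))
  rw [key _ (by omega) (by omega), key _ (by omega) (by omega), key _ (by omega) (by omega)] at hL
  exact hL.trans (by norm_num)

/-- The Faber-Schauder coefficients are uncorrelated. -/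
theorem IsWienerMeasure.covariance_schauderCoeff (hW : IsWienerMeasure W) {i j : SchauderIndex}
    (hij : i ≠ j) :
    cov[fun ω : PathSpace => schauderCoeff i ω.1, fun ω => schauderCoeff j ω.1; W] = 0 := by
  have aux : ∀ (n : ℕ) (k : Fin (2 ^ n)), cov[fun ω : PathSpace => schauderCoeff none ω.1,
      fun ω => schauderCoeff (some ⟨n, k⟩) ω.1; W] = 0 := fun n k =>
    hW.covariance_eval_schauderCoeff 1 n k (Or.inr (by
      rw [div_le_iff₀ (by positivity)]
      simp only [Icc.coe_one, one_mul]
      exact_mod_cast k.2))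
  rcases i with _ | ⟨n, k⟩ <;> rcases j with _ | ⟨n', k'⟩
  · exact absurd rfl hij
  · exact aux _ _
  · rw [covariance_comm]; exact aux _ _
  · rcases le_total n n' with h | h
    · exact hW.covariance_schauderCoeff_of_le h k k' fun e => hij (by rw [e])
    · rw [covariance_comm]
      exact hW.covariance_schauderCoeff_of_le h k' k fun e => hij (by rw [e])

/-- The variance of a Faber-Schauder coefficient. -/
noncomputable def schauderVar : SchauderIndex → ℝ≥0
  | none => 1
  | some ⟨n, _⟩ => (4 * 2 ^ n)⁻¹

theorem IsWienerMeasure.variance_schauderCoeff (hW : IsWienerMeasure W) (i : SchauderIndex) :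
    Var[fun ω : PathSpace => schauderCoeff i ω.1; W] = schauderVar i := by
  rw [← covariance_self (measurable_schauderCoeff i).aemeasurable]
  rcases i with _ | ⟨n, k⟩
  · simp only [schauderCoeff, hW.covariance_eval, schauderVar]; simp
  · have hk := k.2
    have hL := hW.covariance_midDiff_left (hW.memLp_schauderCoeff (some ⟨n, k⟩))
      (dyadicPt (n + 1) (2 * k)) (dyadicPt (n + 1) (2 * k + 1)) (dyadicPt (n + 1) (2 * k + 2))
    have e0 : (dyadicPt (n + 1) (2 * k) : ℝ) = k / 2 ^ n := by
      rw [dyadicPt_coe (by rw [pow_succ]; omega)]; push_cast; field_simp; ring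
    have e2 : (dyadicPt (n + 1) (2 * k + 2) : ℝ) = (k + 1) / 2 ^ n := by
      rw [dyadicPt_coe (by rw [pow_succ]; omega)]; push_cast; field_simp; ring
    -- The endpoints contribute nothing; the midpoint alone gives half of its distance to the left
    -- endpoint.
    rw [hW.covariance_eval_schauderCoeff _ n k (Or.inl e0.le),
      hW.covariance_eval_schauderCoeff _ n k (Or.inr e2.ge)] at hL
    have hM := hW.covariance_eval_midDiff (dyadicPt (n + 1) (2 * k + 1))
      (dyadicPt (n + 1) (2 * k)) (dyadicPt (n + 1) (2 * k + 1)) (dyadicPt (n + 1) (2 * k + 2))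
    have e1 : (dyadicPt (n + 1) (2 * k + 1) : ℝ) = k / 2 ^ n + 2⁻¹ / 2 ^ n := by
      rw [dyadicPt_coe (by rw [pow_succ]; omega)]; push_cast; field_simp; ring
    have h2 : (0 : ℝ) < 2⁻¹ / 2 ^ n := by positivity
    rw [min_self, min_eq_right (by rw [e0, e1]; linarith),
      min_eq_left (by rw [e1, e2, add_div]; gcongr; norm_num), e0, e1] at hM
    simp only [schauderCoeff] at hL ⊢
    rw [hL, hM, schauderVar]
    push_cast
    field_simp
    ring

theorem IsWienerMeasure.isGaussianProcess_schauderCoeff (hW : IsWienerMeasure W) :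
    IsGaussianProcess (fun (i : SchauderIndex) (ω : PathSpace) => schauderCoeff i ω.1) W := by
  classical
  refine hW.isGaussianProcess.of_isGaussianProcess fun i => ?_
  rcases i with _ | ⟨n, k⟩
  · exact ⟨{1}, .proj ⟨1, by simp⟩, fun ω => rfl⟩
  · generalize hl : dyadicPt (n + 1) (2 * k) = l
    generalize hm : dyadicPt (n + 1) (2 * k + 1) = m
    generalize hr : dyadicPt (n + 1) (2 * k + 2) = r
    refine ⟨{l, m, r}, .proj ⟨m, by simp⟩ -
      (2⁻¹ : ℝ) • (.proj ⟨l, by simp⟩ + .proj ⟨r, by simp⟩), fun ω => ?_⟩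
    simp [schauderCoeff, midDiff, hl, hm, hr]
    ring

theorem IsWienerMeasure.map_schauderCoeff (hW : IsWienerMeasure W) (i : SchauderIndex) :
    W.map (fun ω : PathSpace => schauderCoeff i ω.1) = gaussianReal 0 (schauderVar i) := by
  rw [(hW.isGaussianProcess_schauderCoeff.hasGaussianLaw_eval i).map_eq_gaussianReal,
    hW.variance_schauderCoeff, Real.toNNReal_coe]
  have hint := fun t => (hW.isGaussianProcess.hasGaussianLaw_eval t).integrable
  congr 1
  rcases i with _ | ⟨n, k⟩
  · exact hW.integral_eval 1
  · simp only [schauderCoeff, midDiff]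
    rw [integral_sub (hint _) (((hint _).fun_add (hint _)).div_const 2), integral_div,
      integral_add (hint _) (hint _), hW.integral_eval, hW.integral_eval, hW.integral_eval]
    simp

theorem IsWienerMeasure.iIndepFun_schauderCoeff (hW : IsWienerMeasure W) (s : Finset SchauderIndex) :
    iIndepFun (fun (i : s) (ω : PathSpace) => schauderCoeff i ω.1) W :=
  (hW.isGaussianProcess_schauderCoeff.hasGaussianLaw s).iIndepFun_of_covariance_eq_zero
    fun _ _ hij => hW.covariance_schauderCoeff fun e => hij (Subtype.ext e)

/-- The measure of a finite box of Faber-Schauder coefficients. -/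
theorem IsWienerMeasure.measure_schauderBox (hW : IsWienerMeasure W) (s : Finset SchauderIndex)
    (c b : SchauderIndex → ℝ) :
    W {ω | ∀ i ∈ s, |schauderCoeff i ω.1 - c i| ≤ b i} =
      ∏ i ∈ s, gaussianReal 0 (schauderVar i) (Metric.closedBall (c i) (b i)) := by
  have h := (hW.iIndepFun_schauderCoeff s).measure_inter_preimage_eq_mul Finset.univ
    (sets := fun i : s => Metric.closedBall (c i) (b i))
    (fun i _ => Metric.isClosed_closedBall.measurableSet)
  rw [← Finset.prod_coe_sort]
  convert! h using 1
  · congr 1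
    ext ω
    simp [Real.dist_eq]
  · refine Finset.prod_congr rfl fun i _ => ?_
    rw [← hW.map_schauderCoeff, Measure.map_apply (measurable_schauderCoeff _)
      Metric.isClosed_closedBall.measurableSet]

end Wiener


/-! ### Radii and costs of the boxes -/

theorem summable_two_pow_mul_exp_neg_pow {r : ℝ} (hr : 1 < r) :
    Summable fun n : ℕ => (2 : ℝ) ^ n * Real.exp (-(r ^ n)) := by
  -- With `r ^ p > 2`, the bound `exp (-x) ≤ p! / x ^ p` yields a convergent geometric series.
  obtain ⟨p, hp⟩ := pow_unbounded_of_one_lt 2 hr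
  have hrp : 0 < r ^ p := by positivity
  have hgeo : Summable fun n : ℕ => (p.factorial : ℝ) * (2 / r ^ p) ^ n :=
    (summable_geometric_of_lt_one (by positivity) ((div_lt_one hrp).2 hp)).mul_left _
  refine hgeo.of_nonneg_of_le (fun n => by positivity) fun n => ?_
  have hx : 0 < r ^ n := by positivity
  have h := Real.pow_div_factorial_le_exp (r ^ n) hx.le p
  have h2 : Real.exp (-(r ^ n)) ≤ p.factorial / (r ^ n) ^ p := by
    rw [Real.exp_neg, ← inv_div]
    exact inv_anti₀ (by positivity) h
  calc (2 : ℝ) ^ n * Real.exp (-(r ^ n)) ≤ 2 ^ n * (p.factorial / (r ^ n) ^ p) := by gcongr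
    _ = _ := by rw [div_pow, ← pow_mul, ← pow_mul, mul_comm n p]; ring

/-- Bernoulli's inequality; it absorbs the linear factors `m + 1` in the cost (`x = r`) and in the
radius (`x = 2 * ρ`). -/
theorem succ_le_div_pow {x : ℝ} (h1 : 1 < x) (h2 : x ≤ 2) (m : ℕ) :
    (m : ℝ) + 1 ≤ x ^ m / (x - 1) := by
  rw [le_div_iff₀ (by linarith)]
  have h := one_add_mul_le_pow (a := x - 1) (by linarith) m
  rw [add_sub_cancel] at h
  nlinarith

/-- Radii of a box of Faber-Schauder coefficients, of level of precision `m`. -/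
noncomputable def boxRadius (K ρ : ℝ) (m n : ℕ) : ℝ :=
  if n < m then (1 / 2) ^ m else 2 * (K * ρ ^ n)

/-- The cost of a coefficient of level `n` in the box of level of precision `m`. -/
noncomputable def boxCost (K r A : ℝ) (m n : ℕ) : ℝ :=
  if n < m then A else 4 * Real.exp (-(2 * K ^ 2 * r ^ n))

theorem sum_boxRadius_le {K ρ : ℝ} (hK : 0 ≤ K) (hρ0 : 0 < ρ) (hρ1 : ρ < 1) (m N : ℕ) :
    (1 / 2) ^ m + ∑ n ∈ Finset.range N, boxRadius K ρ m n ≤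
      ((m : ℝ) + 1) * (1 / 2) ^ m + 2 * K / (1 - ρ) * ρ ^ m := by
  have h1ρ : 0 < 1 - ρ := by linarith
  -- The geometric tail is kept as a telescoping difference so that induction closes.
  have key : (1 / 2) ^ m + ∑ n ∈ Finset.range N, boxRadius K ρ m n ≤
      ((min N m : ℕ) + 1 : ℝ) * (1 / 2) ^ m + 2 * K / (1 - ρ) * (ρ ^ m - ρ ^ max N m) := by
    induction N with
    | zero => simp
    | succ N ih =>
      rw [Finset.sum_range_succ]
      rcases lt_or_ge N m with h | h
      · rw [min_eq_left h.le, max_eq_right h.le] at ih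
        rw [min_eq_left h, max_eq_right h, boxRadius, if_pos h]
        push_cast
        linarith
      · rw [min_eq_right h, max_eq_left h] at ih
        rw [min_eq_right (h.trans N.le_succ), max_eq_left (h.trans N.le_succ), boxRadius,
          if_neg h.not_gt]
        have e : 2 * (K * ρ ^ N) = 2 * K / (1 - ρ) * (ρ ^ N - ρ ^ (N + 1)) := by
          field_simp; ring
        rw [e, Nat.succ_eq_add_one]
        linarith
  refine key.trans ?_
  have h1 : ((min N m : ℕ) : ℝ) ≤ m := by exact_mod_cast min_le_right N m
  have h2 : ρ ^ m - ρ ^ max N m ≤ ρ ^ m := by linarith [pow_pos hρ0 (max N m)]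
  gcongr

theorem sum_boxCost_le {K r A : ℝ} (hA : 0 ≤ A) (hK : 1 ≤ K) (hr : 1 < r) (m N : ℕ) :
    A + ∑ n ∈ Finset.range N, 2 ^ n * boxCost K r A m n ≤
      A * 2 ^ m + 4 * ∑' n : ℕ, (2 : ℝ) ^ n * Real.exp (-(r ^ n)) := by
  -- The isolated `A`, the cost of index `none`, completes `1 + 2 + ... + 2 ^ (N - 1)` to `2 ^ N`.
  have key : A + ∑ n ∈ Finset.range N, 2 ^ n * boxCost K r A m n ≤
      A * 2 ^ min N m + 4 * ∑ n ∈ Finset.range N, (2 : ℝ) ^ n * Real.exp (-(r ^ n)) := by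
    induction N with
    | zero => simp
    | succ N ih =>
      rw [Finset.sum_range_succ, Finset.sum_range_succ]
      rcases lt_or_ge N m with h | h
      · rw [min_eq_left h.le] at ih
        rw [min_eq_left h, boxCost, if_pos h, pow_succ]
        have : 0 ≤ (2 : ℝ) ^ N * Real.exp (-(r ^ N)) := by positivity
        linarith
      · rw [min_eq_right h] at ih
        rw [min_eq_right (h.trans N.le_succ), boxCost, if_neg h.not_gt]
        have h1 : Real.exp (-(2 * K ^ 2 * r ^ N)) ≤ Real.exp (-(r ^ N)) := by
          refine Real.exp_le_exp.2 (neg_le_neg ?_)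
          have : 0 < r ^ N := by positivity
          exact le_mul_of_one_le_left this.le (by nlinarith)
        have h2 : (2 : ℝ) ^ N * (4 * Real.exp (-(2 * K ^ 2 * r ^ N))) ≤
            4 * (2 ^ N * Real.exp (-(r ^ N))) := by
          rw [mul_left_comm]; gcongr
        linarith
  refine key.trans ?_
  have := (summable_two_pow_mul_exp_neg_pow hr).sum_le_tsum (Finset.range N)
    (fun n _ => by positivity)
  gcongr
  · norm_num
  · exact min_le_right _ _

theorem exp_neg_succ_le_half_pow (m : ℕ) : Real.exp (-((m : ℝ) + 1)) ≤ (1 / 2) ^ m / 2 := by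
  have h : Real.exp (-1) ≤ 1 / 2 := by
    rw [Real.exp_neg, one_div]
    exact inv_anti₀ (by norm_num) (by linarith [Real.add_one_le_exp (1 : ℝ)])
  calc Real.exp (-((m : ℝ) + 1)) = Real.exp (-1) ^ (m + 1) := by
        rw [← Real.exp_nat_mul]; congr 1; push_cast; ring
    _ ≤ (1 / 2) ^ (m + 1) := by gcongr
    _ = _ := by rw [pow_succ]; ring

/-- The cost splits into the Gaussian exponent at distance `R` and `m + 1` for the length of the
interval. -/
theorem gaussianReal_closedBall_half_pow_ge {v : ℝ≥0} (hv : v ≠ 0) (hv1 : v ≤ 1) {c R A : ℝ}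
    {m : ℕ} (hR : |c| + (1 / 2) ^ m ≤ R) (hA : R ^ 2 / (2 * v) + (m + 1) ≤ A) :
    ENNReal.ofReal (Real.exp (-A)) ≤
      gaussianReal 0 v (Metric.closedBall c ((1 / 2) ^ m)) := by
  refine le_trans (ENNReal.ofReal_le_ofReal ?_) (gaussianReal_closedBall_ge hv hv1 hR)
  calc Real.exp (-A) ≤ Real.exp (-((m : ℝ) + 1) + -(R ^ 2 / (2 * v))) :=
        Real.exp_le_exp.2 (by linarith)
    _ ≤ _ := by
        rw [Real.exp_add]
        gcongr
        exact exp_neg_succ_le_half_pow m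

/-- Bound for one factor of the measure of a box of Faber-Schauder coefficients. -/
theorem exp_neg_boxCost_le {K ρ A : ℝ} {m n : ℕ} {c : ℝ} (hK : 1 ≤ K) (hρ : 1 / 2 ≤ ρ)
    (hr : 1 ≤ 2 * ρ ^ 2) (hA : 8 * K ^ 2 * (2 * ρ ^ 2) ^ m + (m + 1) ≤ A)
    (hc : |c| ≤ K * ρ ^ n) :
    ENNReal.ofReal (Real.exp (-boxCost K (2 * ρ ^ 2) A m n)) ≤
      gaussianReal 0 (4 * 2 ^ n)⁻¹ (Metric.closedBall c (boxRadius K ρ m n)) := by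
  have hv : ∀ x : ℝ, x ^ 2 * (ρ ^ n) ^ 2 / (2 * (((4 * 2 ^ n)⁻¹ : ℝ≥0) : ℝ)) =
      2 * x ^ 2 * (2 * ρ ^ 2) ^ n := by
    intro x
    push_cast
    rw [mul_pow, ← pow_mul, ← pow_mul, mul_comm n 2]
    field_simp
    ring
  rw [boxCost, boxRadius]
  split_ifs with h
  -- Since `ρ ≥ 1/2`, the radius is at most the bound on the center, so `R = 2 * (K * ρ ^ n)` works.
  · have hpow : (1 / 2 : ℝ) ^ m ≤ K * ρ ^ n := by
      calc (1 / 2 : ℝ) ^ m ≤ (1 / 2) ^ n := pow_le_pow_of_le_one (by norm_num) (by norm_num) h.le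
        _ ≤ ρ ^ n := by gcongr
        _ ≤ K * ρ ^ n := le_mul_of_one_le_left (by positivity) hK
    refine gaussianReal_closedBall_half_pow_ge (R := 2 * (K * ρ ^ n)) (by positivity) ?_
      (by linarith) ?_
    · refine inv_le_one_of_one_le₀ ?_
      have : (1 : ℝ≥0) ≤ 2 ^ n := one_le_pow₀ (by norm_num)
      calc (1 : ℝ≥0) ≤ 4 * 1 := by norm_num
        _ ≤ 4 * 2 ^ n := by gcongr
    · have e : (2 * (K * ρ ^ n)) ^ 2 = (2 * K) ^ 2 * (ρ ^ n) ^ 2 := by ring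
      rw [e, hv]
      have := pow_le_pow_right₀ hr h.le
      nlinarith [mul_le_mul_of_nonneg_left this (by positivity : 0 ≤ 8 * K ^ 2)]
  · have e : (K * ρ ^ n) ^ 2 / (2 * (((4 * 2 ^ n)⁻¹ : ℝ≥0) : ℝ)) =
        2 * K ^ 2 * (2 * ρ ^ 2) ^ n := by rw [mul_pow, hv]
    have h1 := gaussianReal_closedBall_ge_exp (v := (4 * 2 ^ n)⁻¹) hc
    rw [e] at h1
    refine h1 ?_
    have h2 : (2 : ℝ) ≤ 2 * K ^ 2 * (2 * ρ ^ 2) ^ n := by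
      have := one_le_pow₀ hr (n := n)
      nlinarith
    have h3 : Real.exp (-(2 * K ^ 2 * (2 * ρ ^ 2) ^ n)) ≤ 1 / 4 := by
      calc Real.exp (-(2 * K ^ 2 * (2 * ρ ^ 2) ^ n)) ≤ Real.exp (-2) :=
            Real.exp_le_exp.2 (by linarith)
        _ = Real.exp (-1) ^ 2 := by rw [← Real.exp_nat_mul]; norm_num
        _ ≤ (1 / 2) ^ 2 := by
            gcongr
            simpa using! exp_neg_succ_le_half_pow 0
        _ = 1 / 4 := by norm_num
    linarith

/-! ### Measure of balls of the Wiener space -/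

/-- The indices of level less than `N`. -/
def schauderIndicesBelow (N : ℕ) : Finset SchauderIndex :=
  Finset.insertNone ((Finset.range N).sigma fun _ => Finset.univ)

/-- A lower bound for the measure of balls of the Wiener space, in terms of the decay of the
Faber-Schauder coefficients of the center. -/
theorem IsWienerMeasure.measure_closedBall_ge {W : Measure PathSpace} (hW : IsWienerMeasure W)
    (ω : PathSpace) {K ρ : ℝ} (hK : 1 ≤ K) (hρ : 1 / 2 ≤ ρ) (hρ1 : ρ < 1) (hr : 1 < 2 * ρ ^ 2)
    (h_none : |schauderCoeff none ω.1| ≤ K)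
    (h_some : ∀ n (k : Fin (2 ^ n)), |schauderCoeff (some ⟨n, k⟩) ω.1| ≤ K * ρ ^ n)
    {A : ℝ} {m : ℕ} (hA : 8 * K ^ 2 * (2 * ρ ^ 2) ^ m + (m + 1) ≤ A) :
    ENNReal.ofReal (Real.exp
        (-(A * 2 ^ m + 4 * ∑' n : ℕ, (2 : ℝ) ^ n * Real.exp (-((2 * ρ ^ 2) ^ n))))) ≤
      W (Metric.closedBall ω (((m : ℝ) + 1) * (1 / 2) ^ m + 2 * K / (1 - ρ) * ρ ^ m)) := by
  have := hW.isProbabilityMeasure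
  have hA0 : 0 ≤ A := le_trans (by positivity) hA
  set b : SchauderIndex → ℝ := fun i => i.elim ((1 / 2) ^ m) fun j => boxRadius K ρ m j.1 with hb
  set a : SchauderIndex → ℝ := fun i => i.elim A fun j => boxCost K (2 * ρ ^ 2) A m j.1 with ha
  have hfac : ∀ i, ENNReal.ofReal (Real.exp (-a i)) ≤
      gaussianReal 0 (schauderVar i) (Metric.closedBall (schauderCoeff i ω.1) (b i)) := by
    rintro (_ | ⟨n, k⟩)
    · refine gaussianReal_closedBall_half_pow_ge (R := 2 * K) one_ne_zero le_rfl ?_ ?_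
      · have : (1 / 2 : ℝ) ^ m ≤ 1 := pow_le_one₀ (by norm_num) (by norm_num)
        linarith
      · have := one_le_pow₀ hr.le (n := m)
        have h2 := le_mul_of_one_le_right (by positivity : 0 ≤ 8 * K ^ 2) this
        change (2 * K) ^ 2 / (2 * 1) + ((m : ℝ) + 1) ≤ A
        nlinarith
    · exact exp_neg_boxCost_le hK hρ hr.le hA (h_some n k)
  set E : ℕ → Set PathSpace := fun N =>
    {ω' | ∀ i ∈ schauderIndicesBelow N, |schauderCoeff i ω'.1 - schauderCoeff i ω.1| ≤ b i} with hE
  have hmono : Monotone schauderIndicesBelow := fun N N' h =>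
    Finset.insertNone.monotone (Finset.sigma_mono (Finset.range_mono h) fun _ => le_rfl)
  have hanti : Antitone E := fun N N' h ω' hω' i hi => hω' i (hmono h hi)
  have hmeas : ∀ N, MeasurableSet (E N) := by
    intro N
    have : E N = ⋂ i ∈ schauderIndicesBelow N,
        {ω' | |schauderCoeff i ω'.1 - schauderCoeff i ω.1| ≤ b i} := by ext; simp [hE]
    rw [this]
    refine Finset.measurableSet_biInter _ fun i _ => measurableSet_le ?_ measurable_const
    exact ((measurable_schauderCoeff i).sub_const _).abs
  have hsub : ⋂ N, E N ⊆
      Metric.closedBall ω (((m : ℝ) + 1) * (1 / 2) ^ m + 2 * K / (1 - ρ) * ρ ^ m) := by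
    intro ω' hω'
    rw [mem_iInter] at hω'
    have hS0 : (0 : ℝ) ≤ ((m : ℝ) + 1) * (1 / 2) ^ m + 2 * K / (1 - ρ) * ρ ^ m := by
      have : 0 < 1 - ρ := by linarith
      positivity
    rw [Metric.mem_closedBall, Subtype.dist_eq, ContinuousMap.dist_le hS0]
    intro t
    rw [Real.dist_eq]
    refine abs_le_of_schauderCoeff (f := fun t => ω'.1 t - ω.1 t) (B := (1 / 2) ^ m)
      (b := boxRadius K ρ m) (by fun_prop) (by simp [ω'.2, ω.2]) ?_ (fun n k => ?_)
      (sum_boxRadius_le (by linarith) (by linarith) hρ1 m) t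
    · rw [schauderCoeff_sub]
      exact hω' 0 none (by simp [schauderIndicesBelow])
    · rw [schauderCoeff_sub]
      exact hω' (n + 1) (some ⟨n, k⟩) (by simp [schauderIndicesBelow])
  refine le_trans ?_ (measure_mono hsub)
  -- Continuity from above reduces the infinite box to finite ones, bounded uniformly in `N`.
  rw [hanti.measure_iInter (fun N => (hmeas N).nullMeasurableSet) ⟨0, measure_ne_top _ _⟩]
  refine le_iInf fun N => ?_
  rw [hE, hW.measure_schauderBox]
  refine le_trans ?_ (Finset.prod_le_prod' fun i _ => hfac i)
  rw [← ENNReal.ofReal_prod_of_nonneg fun _ _ => (Real.exp_pos _).le, ← Real.exp_sum,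
    Finset.sum_neg_distrib]
  refine ENNReal.ofReal_le_ofReal (Real.exp_le_exp.2 (neg_le_neg ?_))
  refine le_trans (le_of_eq ?_) (sum_boxCost_le hA0 hK hr m N)
  rw [schauderIndicesBelow, Finset.sum_insertNone, Finset.sum_sigma]
  simp [ha]

/-! ### Hölder centers and the order -/

/-- A coefficient is half the difference of two adjacent increments of step `2 ^ (-(n + 1))`. -/
theorem abs_schauderCoeff_le_of_holderWith {C β : ℝ≥0} {f : I → ℝ} (hf : HolderWith C β f)
    (n : ℕ) (k : Fin (2 ^ n)) :
    |schauderCoeff (some ⟨n, k⟩) f| ≤ C * ((2 : ℝ) ^ (-(β : ℝ))) ^ n := by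
  have hk := k.2
  have hstep : ∀ j, j + 1 ≤ 2 ^ (n + 1) →
      |f (dyadicPt (n + 1) (j + 1)) - f (dyadicPt (n + 1) j)| ≤
        C * ((2 : ℝ) ^ (-(β : ℝ))) ^ n := by
    intro j hj
    have hd : dist (dyadicPt (n + 1) (j + 1)) (dyadicPt (n + 1) j) = (2⁻¹) ^ (n + 1) := by
      rw [Subtype.dist_eq, dyadicPt_coe hj, dyadicPt_coe (Nat.le_of_succ_le hj), Real.dist_eq,
        ← sub_div]
      push_cast
      rw [add_sub_cancel_left, abs_of_pos (by positivity), inv_pow, one_div]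
    rw [← Real.dist_eq]
    refine (hf.dist_le_of_le hd.le).trans ?_
    gcongr
    rw [← Real.rpow_natCast, ← Real.rpow_mul (by norm_num), mul_comm, Real.rpow_mul (by norm_num),
      Real.inv_rpow (by norm_num), ← Real.rpow_neg (by norm_num), Real.rpow_natCast]
    exact pow_le_pow_of_le_one (by positivity)
      (Real.rpow_le_one_of_one_le_of_nonpos (by norm_num) (by simp)) n.le_succ
  have h1 := hstep (2 * k) (by rw [pow_succ]; omega)
  have h2 := hstep (2 * k + 1) (by rw [pow_succ]; omega)
  simp only [schauderCoeff, midDiff]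
  rw [abs_le] at h1 h2 ⊢
  constructor <;> linarith

/-- Source of the exponent: both sides equal `2 ^ ((2 - 2 * β) * m)`. -/
theorem rpow_neg_pow_rpow {β : ℝ} (hβ : β ≠ 0) (m : ℕ) :
    (((2 : ℝ) ^ (-β)) ^ m) ^ (-(2 / β - 2)) = (2 * (2 * ((2 : ℝ) ^ (-β)) ^ 2)) ^ m := by
  have e : 2 * (2 * ((2 : ℝ) ^ (-β)) ^ 2) = 2 ^ (2 - 2 * β) := by
    rw [← Real.rpow_natCast, ← Real.rpow_mul (by norm_num), ← mul_assoc,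
      show (2 : ℝ) - 2 * β = 2 + -β * (2 : ℕ) by push_cast; ring, Real.rpow_add (by norm_num)]
    norm_num
  rw [e, ← Real.rpow_natCast, ← Real.rpow_natCast, ← Real.rpow_mul (by positivity),
    ← Real.rpow_mul (by positivity), ← Real.rpow_mul (by positivity)]
  congr 1
  field_simp

/-- Lower bound for the Wiener measure of small balls around a `β`-Hölder path. -/
theorem IsWienerMeasure.exists_measure_ball_ge {W : Measure PathSpace} (hW : IsWienerMeasure W)
    {ω : PathSpace} {β : ℝ} (hβ0 : 0 < β) (hβ : β < 1 / 2) (hω : ω ∈ holderPaths β) :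
    ∃ C : ℝ, ∀ᶠ ε in 𝓝[>] (0 : ℝ),
      ENNReal.ofReal (Real.exp (-(C * ε ^ (-(2 / β - 2))))) ≤ W (Metric.ball ω ε) := by
  obtain ⟨C₀, hC₀⟩ := hω
  set ρ : ℝ := (2 : ℝ) ^ (-β) with hρdef
  have hρ1 : ρ < 1 := Real.rpow_lt_one_of_one_lt_of_neg (by norm_num) (by linarith)
  have hρhalf : 1 / 2 < ρ := by
    rw [one_div, ← Real.rpow_neg_one]
    exact Real.rpow_lt_rpow_of_exponent_lt (by norm_num) (by linarith)
  have hr : 1 < 2 * ρ ^ 2 := by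
    have e : ρ ^ 2 = (2 : ℝ) ^ (-β * 2) := by
      rw [hρdef, ← Real.rpow_natCast, ← Real.rpow_mul (by norm_num)]; norm_num
    have : (2 : ℝ)⁻¹ < ρ ^ 2 := by
      rw [e, ← Real.rpow_neg_one]
      exact Real.rpow_lt_rpow_of_exponent_lt (by norm_num) (by linarith)
    linarith
  have hr2 : 2 * ρ ^ 2 ≤ 2 := by nlinarith
  set r : ℝ := 2 * ρ ^ 2 with hrdef
  set K : ℝ := max C₀ 1 with hKdef
  have hK : 1 ≤ K := le_max_right _ _
  have hCK : (C₀ : ℝ) ≤ K := le_max_left _ _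
  have h_none : |schauderCoeff none ω.1| ≤ K := by
    have h := hC₀.dist_le_of_le (x := 1) (y := 0) (d := 1) (by simp [Subtype.dist_eq])
    rw [ω.2, Real.one_rpow, mul_one, Real.dist_eq, sub_zero] at h
    exact h.trans hCK
  have h_some : ∀ n (k : Fin (2 ^ n)), |schauderCoeff (some ⟨n, k⟩) ω.1| ≤ K * ρ ^ n := by
    intro n k
    have h := abs_schauderCoeff_le_of_holderWith hC₀ n k
    rw [Real.coe_toNNReal _ hβ0.le] at h
    exact h.trans (by gcongr)
  set T : ℝ := 4 * ∑' n : ℕ, (2 : ℝ) ^ n * Real.exp (-(r ^ n)) with hT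
  have hT0 : 0 ≤ T := mul_nonneg (by norm_num) (tsum_nonneg fun n => by positivity)
  have h1ρ : 0 < 1 - ρ := by linarith
  have h2ρ : 0 < 2 * ρ - 1 := by linarith
  have hr1 : 0 < r - 1 := by linarith
  set C₁ : ℝ := 1 / (2 * ρ - 1) + 2 * K / (1 - ρ) with hC₁
  have hC₁0 : 0 < C₁ := by positivity
  set C₂ : ℝ := 8 * K ^ 2 + 1 / (r - 1) + T with hC₂
  have hC₂0 : 0 ≤ C₂ := by positivity
  have hball : ∀ m : ℕ, ENNReal.ofReal (Real.exp (-(C₂ * (2 * r) ^ m))) ≤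
      W (Metric.closedBall ω (C₁ * ρ ^ m)) := by
    intro m
    have h := hW.measure_closedBall_ge ω hK hρhalf.le hρ1 hr h_none h_some (m := m) le_rfl
    refine le_trans (ENNReal.ofReal_le_ofReal (Real.exp_le_exp.2 (neg_le_neg ?_)))
      (h.trans (measure_mono (Metric.closedBall_subset_closedBall ?_)))
    · have h1 := succ_le_div_pow hr hr2 m
      have h2 : (1 : ℝ) ≤ (2 * r) ^ m := one_le_pow₀ (by linarith)
      calc (8 * K ^ 2 * r ^ m + (m + 1)) * 2 ^ m + T
          ≤ (8 * K ^ 2 * r ^ m + r ^ m / (r - 1)) * 2 ^ m + T * (2 * r) ^ m := by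
            gcongr
            exact le_mul_of_one_le_right hT0 h2
        _ = _ := by rw [hC₂, mul_pow 2 r m]; ring
    · have h1 := succ_le_div_pow (x := 2 * ρ) (by linarith) (by linarith) m
      calc ((m : ℝ) + 1) * (1 / 2) ^ m + 2 * K / (1 - ρ) * ρ ^ m
          ≤ (2 * ρ) ^ m / (2 * ρ - 1) * (1 / 2) ^ m + 2 * K / (1 - ρ) * ρ ^ m := by gcongr
        _ = _ := by
            rw [hC₁, mul_pow, one_div_pow]
            field_simp
  have hθ : 0 < 2 / β - 2 := by
    rw [sub_pos, lt_div_iff₀ hβ0]; linarith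
  set θ : ℝ := 2 / β - 2 with hθdef
  refine ⟨C₂ * (ρ / (2 * C₁)) ^ (-θ), ?_⟩
  have hmem : Ioo (0 : ℝ) C₁ ∈ 𝓝[>] (0 : ℝ) := Ioo_mem_nhdsGT hC₁0
  filter_upwards [hmem] with ε hε
  have hε0 : 0 < ε := hε.1
  -- The level `m + 1` ball fits inside radius `ε`, while `ρ ^ (m + 1) ≥ ρ * ε / (2 * C₁)` keeps the
  -- cost of order `ε ^ (-θ)`.
  obtain ⟨m, hm1, hm2⟩ := exists_nat_pow_near_of_lt_one (x := ε / (2 * C₁)) (y := ρ)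
    (by positivity) (by rw [div_le_one (by positivity)]; linarith [hε.2]) (by linarith) hρ1
  rw [lt_div_iff₀ (by positivity)] at hm1
  refine le_trans ?_ ((hball (m + 1)).trans (measure_mono (Metric.closedBall_subset_ball ?_)))
  · refine ENNReal.ofReal_le_ofReal (Real.exp_le_exp.2 (neg_le_neg ?_))
    rw [mul_assoc]
    gcongr
    rw [← rpow_neg_pow_rpow hβ0.ne', ← Real.mul_rpow (by positivity) hε0.le]
    refine Real.rpow_le_rpow_of_nonpos (by positivity) ?_ (by linarith)
    rw [← hρdef, pow_succ]
    calc ρ / (2 * C₁) * ε = ε / (2 * C₁) * ρ := by ring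
      _ ≤ ρ ^ m * ρ := by gcongr
  · have : 0 < C₁ * ρ ^ (m + 1) := by positivity
    linarith

theorem tendsto_rpow_neg_sub_atTop {γ θ : ℝ} (C : ℝ) (hθ : 0 < θ) (hγ : θ < γ) :
    Tendsto (fun ε : ℝ => ε ^ (-γ) - C * ε ^ (-θ)) (𝓝[>] 0) atTop := by
  have h1 := tendsto_rpow_neg_nhdsGT_zero (neg_lt_zero.2 hθ)
  have h2 := tendsto_rpow_neg_nhdsGT_zero (neg_lt_zero.2 (sub_pos.2 hγ))
  have h3 := h1.atTop_mul_atTop₀ (tendsto_atTop_add_const_right _ (-C) h2)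
  refine h3.congr' ?_
  filter_upwards [self_mem_nhdsWithin] with ε hε
  rw [mul_add, ← Real.rpow_add hε]
  ring_nf

theorem mainTheorem9 (W : Measure PathSpace) (hW : IsWienerMeasure W)
    (α : ℝ) (hα : α ∈ Set.Ioc (0 : ℝ) (1 / 2))
    (ω : PathSpace) (hω : ω ∈ nearlyHolderPaths α) :
    upperLocalOrder W ω ≤ ((2 * (α⁻¹ - 1) : ℝ) : EReal) := by
  obtain ⟨hα0, hα2⟩ := hα
  refine EReal.le_of_forall_lt_iff_le.1 fun γ hγ => ?_
  have hγ : 2 * (α⁻¹ - 1) < γ := by exact_mod_cast hγ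
  have hα2' : 2 ≤ α⁻¹ := by
    rw [le_inv_comm₀ (by norm_num) hα0]; simpa using hα2
  obtain ⟨β, hβα, hβγ⟩ : ∃ β ∈ Ioo 0 α, 2 / β - 2 < γ := by
    -- The midpoint of `2 / (γ + 2)` and `α`; `2 / β - 2 < γ` amounts to `β > 2 / (γ + 2)`.
    refine ⟨α - (α - 2 / (γ + 2)) / 2, ?_, ?_⟩
    all_goals
      have h1 : 2 / (γ + 2) < α := by
        rw [div_lt_iff₀ (by linarith)]
        have : α * α⁻¹ = 1 := mul_inv_cancel₀ hα0.ne'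
        nlinarith
      have h2 : 0 < 2 / (γ + 2) := div_pos (by norm_num) (by linarith)
    · exact ⟨by linarith, by linarith⟩
    · rw [sub_lt_iff_lt_add, div_lt_comm₀ (by linarith) (by linarith)]
      linarith
  have hθ : 0 < 2 / β - 2 := by
    rw [sub_pos, lt_div_iff₀ hβα.1]; linarith [hβα.2]
  have hβω : ω ∈ holderPaths β := by
    simp only [nearlyHolderPaths, mem_iInter] at hω
    exact hω β hβα
  obtain ⟨C, hC⟩ := hW.exists_measure_ball_ge hβα.1 (hβα.2.trans_le hα2) hβω
  refine sInf_le ⟨γ, ⟨hθ.trans hβγ, ?_⟩, rfl⟩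
  have hlim : Tendsto (fun ε : ℝ => ENNReal.ofReal (Real.exp (ε ^ (-γ) - C * ε ^ (-(2 / β - 2)))))
      (𝓝[>] 0) (𝓝 ⊤) :=
    ENNReal.tendsto_ofReal_atTop.comp
      (Real.tendsto_exp_atTop.comp (tendsto_rpow_neg_sub_atTop C hθ hβγ))
  refine tendsto_nhds_top_mono hlim ?_
  filter_upwards [hC] with ε hε
  rw [ENNReal.le_div_iff_mul_le (Or.inl (by simp [ordScaling, Real.exp_pos]))
    (Or.inl ENNReal.ofReal_ne_top), ← ENNReal.ofReal_mul (Real.exp_pos _).le, ordScaling,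
    ← Real.exp_add]
  refine le_trans (le_of_eq ?_) hε
  congr 2
  ring
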